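/- Let $G$ be a finite simple graph. For a matching $M$ of $G$, an $M$-alternating path is a path of $G$ (without repeated vertices) whose consecutive edges alternately lie in $M$ and outside $M$. An $M$-alternating path $P'=w_1\dots w_k$ replaces an $M$-alternating path $P=v_1\dots v_\ell$ if $V(P')\subseteq V(P)$, $w_1=v_1$, $w_k=v_\ell$, and ($v_1v_2\in M\iff w_1w_2\in M$) and ($v_{\ell-1}v_\ell\in M\iff w_{k-1}w_k\in M$). (If $P$ has no edge, the last two conditions are void.) $G$ is $r$-replaceable if for every matching $M$ of $G$ every $M$-alternating path can be replaced by an $M$-alternating path with at most $r$ edges. A module of $G$ is a set $A\subseteq V(G)$ such that all vertices of $A$ have the same neighbours outside $A$; it is strong if every module $B$ satisfies $A\cap B=\emptyset$, $A\subseteq B$ or $B\subseteq A$. A graph is prime if its only modules are $\emptyset$, the whole vertex set and the singletons. The modular partition of a graph with at least two vertices consists of its maximal nonempty strong modules different from the whole vertex set; the quotient graph has these parts as vertices, two parts being adjacent if some edge joins them. The modular decomposition tree has root $V(G)$, and the children of a node $S$ with $|S|\ge 2$ are the parts of the modular partition of $G[S]$; nodes with at most one vertex are leaves. A node $S$ with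 $|S|\ge 2$ is prime if the quotient graph of $G[S]$ is prime. The modular-width $\mathrm{mw}(G)$ is the largest number of children of a prime node, but at least $2$; the modular-depth $\mathrm{md}(G)$ is the depth of the tree (the largest number of edges on a path from the root to a node). **Theorem.** There is a constant $c\ge 1$ such that every finite simple graph $G$ is $(c\cdot\mathrm{mw}(G))^{\mathrm{md}(G)}$-replaceable; in fact $c=21$ works. -/

import Mathlib

namespace ModularMatching

universe u

section AlternatingPaths

variable {V : Type u} {G : SimpleGraph V}

/-- A path in `G` (no repeated vertices) whose consecutive edges alternate between edges that lie
in `M` (red) and edges that do not (blue). -/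
structure IsAlternatingPath (M : G.Subgraph) {u v : V} (p : G.Walk u v) : Prop where
  isPath : p.IsPath
  alternates : p.edges.IsChain (fun e f => e ∈ M.edgeSet ↔ f ∉ M.edgeSet)

/-- The `M`-alternating path `q` replaces `p`: it has the same endpoints, only visits vertices of
`p`, and its first (last) edge is in `M` iff the first (last) edge of `p` is.
(If `p` has no edge, then neither has `q`, and the last two conditions hold trivially.) -/
structure Replaces (M : G.Subgraph) {u v : V} (q p : G.Walk u v) : Prop where
  isAlternatingPath : IsAlternatingPath M q
  support_subset : ∀ x ∈ q.support, x ∈ p.support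
  first_edge : M.Adj u p.snd ↔ M.Adj u q.snd
  last_edge : M.Adj p.penultimate v ↔ M.Adj q.penultimate v

/-- For every matching `M` of `G`, each `M`-alternating path can be replaced by one with at most
`l` edges. -/
def IsReplaceable (G : SimpleGraph V) (l : ℕ) : Prop :=
  ∀ M : G.Subgraph, M.IsMatching → ∀ (u v : V) (p : G.Walk u v), IsAlternatingPath M p →
    ∃ q : G.Walk u v, Replaces M q p ∧ q.length ≤ l

end AlternatingPaths

section ModularDecomposition

variable {V : Type u}

/-- All vertices of `A` have the same neighbours outside `A`. -/
def IsModule (G : SimpleGraph V) (A : Set V) : Prop :=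
  ∀ v ∈ A, ∀ w ∈ A, G.neighborSet v ∩ Aᶜ = G.neighborSet w ∩ Aᶜ

/-- A module that overlaps no other module. -/
def IsStrongModule (G : SimpleGraph V) (A : Set V) : Prop :=
  IsModule G A ∧ ∀ B : Set V, IsModule G B → A ∩ B = ∅ ∨ A ⊆ B ∨ B ⊆ A

/-- A graph all of whose modules are trivial. -/
def IsPrime (G : SimpleGraph V) : Prop :=
  ∀ A : Set V, IsModule G A → A = ∅ ∨ A = Set.univ ∨ ∃ v, A = {v}

/-- The modular partition: the inclusion-maximal members among the nonempty strong modules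
different from the whole vertex set. It is empty if `G` has at most one vertex. -/
def modularPartition (G : SimpleGraph V) : Set (Set V) :=
  {A | Maximal (fun B : Set V => IsStrongModule G B ∧ B.Nonempty ∧ B ≠ Set.univ) A}

/-- The quotient graph of the modular partition: two different parts are joined if there is an edge
of `G` between them. -/
def quotientGraph (G : SimpleGraph V) : SimpleGraph (modularPartition G) where
  Adj A B := A ≠ B ∧ ∃ x ∈ (A : Set V), ∃ y ∈ (B : Set V), G.Adj x y
  symm := by
    constructor
    rintro A B ⟨hne, x, hx, y, hy, h⟩
    exact ⟨hne.symm, y, hy, x, hx, h.symm⟩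
  loopless := by
    constructor
    rintro A ⟨hne, _⟩
    exact hne rfl

/-- The children of the node `S` (a vertex set of `G`) in the modular decomposition tree: the parts
of the modular partition of `G[S]`, as vertex sets of `G`. -/
def children (G : SimpleGraph V) (S : Set V) : Set (Set V) :=
  (fun A : Set S => Subtype.val '' A) '' modularPartition (G.induce S)

/-- `IsNodeAt G d S`: the vertex set `S` is a node at depth `d` (`d` edges below the root) of the
modular decomposition tree of `G`. -/
inductive IsNodeAt (G : SimpleGraph V) : ℕ → Set V → Prop
  | root : IsNodeAt G 0 Set.univ
  | child {d : ℕ} {S T : Set V} (hS : IsNodeAt G d S) (hT : T ∈ children G S) :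
      IsNodeAt G (d + 1) T

/-- The node `S` is a prime node: the quotient graph of `G[S]` is prime. -/
def IsPrimeNode (G : SimpleGraph V) (S : Set V) : Prop :=
  IsPrime (quotientGraph (G.induce S))

/-- The modular-width: the largest number of children of a prime node, but at least `2`. -/
noncomputable def modularWidth (G : SimpleGraph V) : ℕ :=
  max 2 (sSup {k | ∃ d S, IsNodeAt G d S ∧ IsPrimeNode G S ∧ (children G S).ncard = k})

/-- The modular-depth: the depth of the modular decomposition tree, i.e. the largest number of
edges on a path from the root to a node. -/
noncomputable def modularDepth (G : SimpleGraph V) : ℕ :=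
  sSup {d | ∃ S, IsNodeAt G d S}

end ModularDecomposition

end ModularMatching

/-! Call edges in `M` red and the others blue. Replace a given alternating path by a shortest
replacement; the result is reduced, and so is each of its segments (`IsReduced.segment`). A reduced
path has no blue chord joining the ends of a longer segment that starts and ends with blue edges,
since the chord would replace the segment (`IsReduced.not_adj`).

Descend the modular decomposition tree. Inside a node `S`, colour the vertices by the children of
`S` and count the path edges that change colour. By Gallai's trichotomy, either no edges run between
different children, or all do, or the quotient is prime. In the first case nothing crosses. In the
others, many crossings would produce a forbidden blue chord: at most 7 crossings are possible when
all edges are present, and at most 4 per child at a prime node, because children are modules. So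
there are at most `4 * modularWidth G` crossings (`IsReduced.card_crossings_le_of_join`,
`IsReduced.card_crossings_le_of_modules`). Between crossings the path stays in one child, where
induction bounds its length; each level of the tree costs one factor `21 * modularWidth G`
(`IsReduced.le_of_isNodeAt`). -/

namespace ModularMatching

universe u

/-! ### Modules and Gallai's trichotomy for the modular partition. -/

section Modules

variable {V : Type u} {G : SimpleGraph V}

lemma isModule_iff {A : Set V} :
    IsModule G A ↔ ∀ v ∈ A, ∀ w ∈ A, ∀ z ∉ A, G.Adj v z → G.Adj w z := by
  constructor
  · intro h v hv w hw z hz hvz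
    have : z ∈ G.neighborSet w ∩ Aᶜ := by
      rw [← h v hv w hw]
      exact ⟨hvz, hz⟩
    exact this.1
  · intro h v hv w hw
    ext z
    exact ⟨fun hz => ⟨h v hv w hw z hz.2 hz.1, hz.2⟩, fun hz => ⟨h w hw v hv z hz.2 hz.1, hz.2⟩⟩

lemma isModule_compl {A : Set V} : IsModule Gᶜ A ↔ IsModule G A := by
  simp only [isModule_iff, SimpleGraph.compl_adj]
  constructor
  · intro h v hv w hw z hz hvz
    by_contra hwz
    exact (h w hw v hv z hz ⟨fun e => hz (e ▸ hw), hwz⟩).2 hvz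
  · rintro h v hv w hw z hz ⟨-, hvz⟩
    exact ⟨fun e => hz (e ▸ hw), fun hwz => hvz (h w hw v hv z hz hwz)⟩

lemma isStrongModule_compl {A : Set V} : IsStrongModule Gᶜ A ↔ IsStrongModule G A := by
  simp only [IsStrongModule, isModule_compl]

/-- Reduces the case of a disconnected complement in the trichotomy to that of a disconnected graph.
-/
lemma modularPartition_compl : modularPartition Gᶜ = modularPartition G := by
  simp only [modularPartition, isStrongModule_compl]

lemma maximal_of_mem_modularPartition {A : Set V} (hA : A ∈ modularPartition G) :
    Maximal (fun B : Set V => IsStrongModule G B ∧ B.Nonempty ∧ B ≠ Set.univ) A :=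
  hA

lemma isStrongModule_singleton (v : V) : IsStrongModule G {v} := by
  refine ⟨isModule_iff.2 ?_, fun B _ => ?_⟩
  · rintro x rfl y rfl z _ h
    exact h
  · by_cases h : v ∈ B
    · exact Or.inr (Or.inl (Set.singleton_subset_iff.2 h))
    · exact Or.inl (Set.singleton_inter_eq_empty.2 h)

/-- Every nonempty proper strong module is contained in a part of the modular partition. -/
lemma exists_modularPartition_superset [Finite V] {A : Set V} (hA : IsStrongModule G A)
    (hne : A.Nonempty) (hA' : A ≠ Set.univ) : ∃ B ∈ modularPartition G, A ⊆ B := by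
  obtain ⟨B, hAB, hB⟩ := (Set.toFinite
    {B : Set V | IsStrongModule G B ∧ B.Nonempty ∧ B ≠ Set.univ}).exists_le_maximal
      (show A ∈ _ from ⟨hA, hne, hA'⟩)
  exact ⟨B, hB, hAB⟩

lemma exists_mem_modularPartition [Finite V] [Nontrivial V] (G : SimpleGraph V) (v : V) :
    ∃ B ∈ modularPartition G, v ∈ B := by
  obtain ⟨B, hB, h⟩ := exists_modularPartition_superset (isStrongModule_singleton (G := G) v)
    (Set.singleton_nonempty v) (Set.singleton_ne_univ v)
  exact ⟨B, hB, h rfl⟩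

lemma eq_of_mem_modularPartition {A B : Set V} (hA : A ∈ modularPartition G)
    (hB : B ∈ modularPartition G) {v : V} (hvA : v ∈ A) (hvB : v ∈ B) : A = B := by
  replace hA := maximal_of_mem_modularPartition hA
  replace hB := maximal_of_mem_modularPartition hB
  rcases hA.prop.1.2 B hB.prop.1.1 with h | h | h
  · exact absurd (show v ∈ A ∩ B from ⟨hvA, hvB⟩) (by simp [h])
  · exact hA.eq_of_le hB.prop h
  · exact (hB.eq_of_le hA.prop h).symm

/-- If a module `B` overlapped `C`, a walk inside `C` would leave `B` along some edge; a vertex of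
`B` outside `C` would then also be adjacent to the far end of that edge, hence lie in `C`. -/
lemma isStrongModule_connectedComponent (C : G.ConnectedComponent) : IsStrongModule G C.supp := by
  refine ⟨isModule_iff.2 fun v hv w hw z hz hvz => ?_, fun B hB => ?_⟩
  · exact absurd (C.mem_supp_of_adj_mem_supp hv hvz) hz
  · classical
    by_contra! ⟨hne, hCB, hBC⟩
    obtain ⟨c, hcC, hcB⟩ := hne
    obtain ⟨x, hxC, hxB⟩ := Set.not_subset.1 hCB
    obtain ⟨b, hbB, hbC⟩ := Set.not_subset.1 hBC
    have hr : G.Reachable c x := C.reachable_of_mem_supp hcC hxC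
    obtain ⟨p⟩ := hr
    obtain ⟨d, hd, hd1, hd2⟩ := p.exists_boundary_dart B hcB hxB
    have hfst : d.fst ∈ C.supp :=
      (C.mem_supp_congr_adj d.adj).2 (by
        have : G.Reachable c d.snd := ⟨p.takeUntil _ (p.dart_snd_mem_support_of_mem_darts hd)⟩
        rw [SimpleGraph.ConnectedComponent.mem_supp_iff] at hcC ⊢
        rw [← hcC]
        exact SimpleGraph.ConnectedComponent.sound this.symm)
    have hsnd : d.snd ∈ C.supp := C.mem_supp_of_adj_mem_supp hfst d.adj
    have hb : G.Adj b d.snd := isModule_iff.1 hB _ hd1 _ hbB _ hd2 d.adj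
    exact hbC (C.mem_supp_of_adj_mem_supp hsnd hb.symm)

/-- If `G` is disconnected, then there is no edge between different parts. -/
lemma mem_part_of_adj_of_not_preconnected [Finite V] (hG : ¬ G.Preconnected) {A : Set V}
    (hA : A ∈ modularPartition G) {x y : V} (hx : x ∈ A) (hxy : G.Adj x y) : y ∈ A := by
  set C := G.connectedComponentMk x
  have hxC : x ∈ C.supp := rfl
  have hC : C.supp ≠ Set.univ := by
    intro h
    refine hG fun a b => C.reachable_of_mem_supp ?_ ?_ <;> rw [h] <;> trivial
  obtain ⟨B, hB, hCB⟩ := exists_modularPartition_superset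
    (isStrongModule_connectedComponent C) ⟨x, hxC⟩ hC
  rw [eq_of_mem_modularPartition hA hB hx (hCB hxC)]
  exact hCB (C.mem_supp_of_adj_mem_supp hxC hxy)

lemma not_preconnected_of_cut {B : Set V} (hB : B.Nonempty) (hB' : Bᶜ.Nonempty)
    (h : ∀ x ∈ Bᶜ, ∀ y ∈ B, ¬ G.Adj x y) : ¬ G.Preconnected := by
  intro hG
  obtain ⟨b, hb⟩ := hB
  obtain ⟨x, hx⟩ := hB'
  obtain ⟨p⟩ := hG b x
  obtain ⟨d, -, hd1, hd2⟩ := p.exists_boundary_dart B hb hx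
  exact h _ hd2 _ hd1 d.adj.symm

lemma IsModule.union {A B : Set V} (hA : IsModule G A) (hB : IsModule G B)
    (hAB : (A ∩ B).Nonempty) : IsModule G (A ∪ B) := by
  rw [isModule_iff] at *
  obtain ⟨c, hcA, hcB⟩ := hAB
  have key : ∀ v ∈ A ∪ B, ∀ z ∉ A ∪ B, (G.Adj v z ↔ G.Adj c z) := by
    rintro v (hv | hv) z hz
    · exact ⟨hA v hv c hcA z fun h => hz (Or.inl h), hA c hcA v hv z fun h => hz (Or.inl h)⟩
    · exact ⟨hB v hv c hcB z fun h => hz (Or.inr h), hB c hcB v hv z fun h => hz (Or.inr h)⟩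
  intro v hv w hw z hz h
  exact (key w hw z hz).2 ((key v hv z hz).1 h)

/-- If `G` and its complement are connected, every nonempty proper module is contained in a part
of the modular partition. -/
lemma IsModule.exists_modularPartition_superset [Finite V] (hG : G.Preconnected)
    (hG' : Gᶜ.Preconnected) {A : Set V} (hA : IsModule G A) (hne : A.Nonempty)
    (hA' : A ≠ Set.univ) : ∃ B ∈ modularPartition G, A ⊆ B := by
  obtain ⟨Q, hAQ, hQ⟩ := (Set.toFinite
    {B : Set V | IsModule G B ∧ B ≠ Set.univ}).exists_le_maximal (show A ∈ _ from ⟨hA, hA'⟩)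
  -- A maximal proper module is strong: if `B` overlaps `Q`, maximality forces `Q ∪ B` to be
  -- everything. Then the pairs between `B` and its complement are all adjacent or all nonadjacent,
  -- so `Gᶜ` or `G` is disconnected.
  have hQs : IsStrongModule G Q := by
    refine ⟨hQ.prop.1, fun B hB => ?_⟩
    by_contra! ⟨hne', hQB, hBQ⟩
    obtain ⟨x, hxQ, hxB⟩ := Set.not_subset.1 hQB
    obtain ⟨b, hbB, hbQ⟩ := Set.not_subset.1 hBQ
    have hU : Q ∪ B = Set.univ := by
      by_contra hU
      exact hbQ (hQ.le_of_ge (y := Q ∪ B) ⟨hQ.prop.1.union hB hne', hU⟩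
        Set.subset_union_left (Or.inr hbB))
    have hBc : ∀ y ∈ Bᶜ, y ∈ Q := fun y hy =>
      (hU ▸ Set.mem_univ y : y ∈ Q ∪ B).resolve_right hy
    have hQm := isModule_iff.1 hQ.prop.1
    have hBm := isModule_iff.1 hB
    have key : ∀ x ∈ Bᶜ, ∀ x' ∈ Bᶜ, ∀ y ∈ B, ∀ y' ∈ B, G.Adj x y → G.Adj x' y' := by
      intro x hx x' hx' y hy y' hy' h
      have h1 : G.Adj x b := (hBm y hy b hbB x hx h.symm).symm
      have h2 : G.Adj x' b := hQm x (hBc x hx) x' (hBc x' hx') b hbQ h1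
      exact (hBm b hbB y' hy' x' hx' h2.symm).symm
    by_cases hxb : G.Adj x b
    · refine not_preconnected_of_cut (G := Gᶜ) ⟨b, hbB⟩ ⟨x, hxB⟩ (fun x' hx' y' hy' h => ?_) hG'
      exact h.2 (key x hxB x' hx' b hbB y' hy' hxb)
    · refine not_preconnected_of_cut (G := G) ⟨b, hbB⟩ ⟨x, hxB⟩ (fun x' hx' y' hy' h => ?_) hG
      exact hxb (key x' hx' x hxB y' hy' b hbB h)
  obtain ⟨B, hB, hQB⟩ := ModularMatching.exists_modularPartition_superset hQs
    (hne.mono hAQ) hQ.prop.2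
  exact ⟨B, hB, Set.Subset.trans hAQ hQB⟩

lemma isPrime_quotientGraph [Finite V] [Nontrivial V] (hG : G.Preconnected)
    (hG' : Gᶜ.Preconnected) : IsPrime (quotientGraph G) := by
  intro 𝒜 h𝒜
  rw [or_iff_not_imp_left, or_iff_not_imp_left]
  intro hne hun
  obtain ⟨A₀, hA₀⟩ := Set.nonempty_iff_ne_empty.2 hne
  obtain ⟨C₀, hC₀⟩ := (Set.ne_univ_iff_exists_notMem _).1 hun
  -- A module of the quotient unites to a module of `G`. As this is proper, it fits into a single
  -- part, so `𝒜` has only one element.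
  have hm : IsModule G (⋃ A ∈ 𝒜, (A : Set V)) := by
    rw [isModule_iff] at h𝒜 ⊢
    simp only [Set.mem_iUnion, not_exists]
    rintro v ⟨A, hA, hv⟩ w ⟨B, hB, hw⟩ z hz hvz
    obtain ⟨C, hC, hzC⟩ := exists_mem_modularPartition G z
    have hC𝒜 : (⟨C, hC⟩ : modularPartition G) ∉ 𝒜 := fun h => hz _ h hzC
    have hAC : (quotientGraph G).Adj A ⟨C, hC⟩ :=
      ⟨fun e => hC𝒜 (e ▸ hA), v, hv, z, hzC, hvz⟩
    obtain ⟨hBC, w', hw', z', hz', h⟩ := h𝒜 A hA B hB _ hC𝒜 hAC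
    have hwB : z' ∉ (B : Set V) := fun h =>
      hBC (Subtype.ext (eq_of_mem_modularPartition B.2 hC h hz'))
    have hwC : w ∉ C := fun h => hBC (Subtype.ext (eq_of_mem_modularPartition B.2 hC hw h))
    have h1 : G.Adj w z' := isModule_iff.1 (maximal_of_mem_modularPartition B.2).prop.1.1 w' hw' w hw z' hwB h
    exact (isModule_iff.1 (maximal_of_mem_modularPartition hC).prop.1.1 z' hz' z hzC w hwC h1.symm).symm
  obtain ⟨B, hB, hAB⟩ := hm.exists_modularPartition_superset hG hG'
    (by
      obtain ⟨v, hv⟩ := (maximal_of_mem_modularPartition A₀.2).prop.2.1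
      exact ⟨v, Set.mem_biUnion hA₀ hv⟩)
    (by
      obtain ⟨v, hv⟩ := (maximal_of_mem_modularPartition C₀.2).prop.2.1
      refine (Set.ne_univ_iff_exists_notMem _).2 ⟨v, fun h => ?_⟩
      simp only [Set.mem_iUnion] at h
      obtain ⟨A, hA, hvA⟩ := h
      exact hC₀ (Subtype.ext (eq_of_mem_modularPartition A.2 C₀.2 hvA hv) ▸ hA))
  have hall : ∀ A ∈ 𝒜, A = ⟨B, hB⟩ := by
    intro A hA
    obtain ⟨v, hv⟩ := (maximal_of_mem_modularPartition A.2).prop.2.1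
    exact Subtype.ext (eq_of_mem_modularPartition A.2 hB hv (hAB (Set.mem_biUnion hA hv)))
  exact ⟨⟨B, hB⟩, Set.eq_singleton_iff_unique_mem.2 ⟨hall A₀ hA₀ ▸ hA₀, hall⟩⟩

/-- Gallai's trichotomy: there are no edges between different parts of the modular partition, or
all of them, or the quotient graph is prime. -/
lemma modularPartition_trichotomy [Finite V] [Nontrivial V] (G : SimpleGraph V) :
    (∀ A ∈ modularPartition G, ∀ x ∈ A, ∀ y ∉ A, ¬ G.Adj x y) ∨
    (∀ A ∈ modularPartition G, ∀ x ∈ A, ∀ y ∉ A, G.Adj x y) ∨ IsPrime (quotientGraph G) := by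
  by_cases hG : G.Preconnected
  · by_cases hG' : Gᶜ.Preconnected
    · exact Or.inr (Or.inr (isPrime_quotientGraph hG hG'))
    · refine Or.inr (Or.inl fun A hA x hx y hy => ?_)
      by_contra hxy
      exact hy (mem_part_of_adj_of_not_preconnected hG' (modularPartition_compl.symm ▸ hA) hx
        ⟨fun e => hy (e ▸ hx), hxy⟩)
  · exact Or.inl fun A hA x hx y hy h => hy (mem_part_of_adj_of_not_preconnected hG hA hx h)

end Modules

/-! ### Alternating paths as sequences, and reduced paths. -/

section Sequences

variable {V : Type u} {G : SimpleGraph V} {M : G.Subgraph}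

/-- `f 0, …, f n` are the vertices of an `M`-alternating path. -/
structure IsAltSeq (M : G.Subgraph) (f : ℕ → V) (n : ℕ) : Prop where
  adj : ∀ i < n, G.Adj (f i) (f (i + 1))
  inj : ∀ i ≤ n, ∀ j ≤ n, f i = f j → i = j
  alt : ∀ i, i + 1 < n → (M.Adj (f i) (f (i + 1)) ↔ ¬ M.Adj (f (i + 1)) (f (i + 2)))

/-- The alternating path `g 0, …, g m` replaces `f 0, …, f n`. -/
structure SeqReplaces (M : G.Subgraph) (g : ℕ → V) (m : ℕ) (f : ℕ → V) (n : ℕ) : Prop where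
  isAltSeq : IsAltSeq M g m
  zero : g 0 = f 0
  last : g m = f n
  mem : ∀ i ≤ m, ∃ j ≤ n, g i = f j
  first_edge : 0 < n → (M.Adj (f 0) (f 1) ↔ M.Adj (g 0) (g 1))
  last_edge : M.Adj (f (n - 1)) (f n) ↔ M.Adj (g (m - 1)) (g m)

/-- An alternating path that no shorter one replaces. -/
def IsReduced (M : G.Subgraph) (f : ℕ → V) (n : ℕ) : Prop :=
  IsAltSeq M f n ∧ ∀ g m, SeqReplaces M g m f n → n ≤ m

lemma SeqReplaces.refl {f : ℕ → V} {n : ℕ} (h : IsAltSeq M f n) : SeqReplaces M f n f n :=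
  ⟨h, rfl, rfl, fun i hi => ⟨i, hi, rfl⟩, fun _ => Iff.rfl, Iff.rfl⟩

lemma SeqReplaces.pos {f g : ℕ → V} {n m : ℕ} (h : SeqReplaces M g m f n) (hf : IsAltSeq M f n)
    (hn : 0 < n) : 0 < m := by
  rcases Nat.eq_zero_or_pos m with rfl | hm
  · have := hf.inj 0 (by omega) n le_rfl (h.zero.symm.trans h.last)
    omega
  · exact hm

lemma SeqReplaces.trans {f g k : ℕ → V} {n m l : ℕ} (hf : IsAltSeq M f n)
    (h₁ : SeqReplaces M k l g m) (h₂ : SeqReplaces M g m f n) : SeqReplaces M k l f n := by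
  refine ⟨h₁.isAltSeq, h₁.zero.trans h₂.zero, h₁.last.trans h₂.last, fun i hi => ?_,
    fun hn => (h₂.first_edge hn).trans (h₁.first_edge (h₂.pos hf hn)),
    h₂.last_edge.trans h₁.last_edge⟩
  obtain ⟨j, hj, hij⟩ := h₁.mem i hi
  obtain ⟨j', hj', hij'⟩ := h₂.mem j hj
  exact ⟨j', hj', hij.trans hij'⟩

lemma exists_isReduced {f : ℕ → V} {n : ℕ} (hf : IsAltSeq M f n) :
    ∃ g m, SeqReplaces M g m f n ∧ IsReduced M g m := by
  classical
  have hex : ∃ m g, SeqReplaces M g m f n := ⟨n, f, SeqReplaces.refl hf⟩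
  obtain ⟨g, hg⟩ := Nat.find_spec hex
  exact ⟨g, Nat.find hex, hg, hg.isAltSeq, fun k l hk => Nat.find_min' hex ⟨k, hk.trans hf hg⟩⟩

lemma IsAltSeq.segment {f : ℕ → V} {n : ℕ} (hf : IsAltSeq M f n) {i j : ℕ} (hj : j ≤ n) :
    IsAltSeq M (fun t => f (i + t)) (j - i) := by
  refine ⟨fun t ht => hf.adj (i + t) (by omega), fun s hs t ht h => ?_,
    fun t ht => hf.alt (i + t) (by omega)⟩
  rcases Nat.lt_or_ge j i with hij | hij
  · omega
  · have := hf.inj (i + s) (by omega) (i + t) (by omega) h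
    omega

/-- Replacing a segment of an alternating path replaces the path. -/
lemma exists_seqReplaces_of_segment {f g : ℕ → V} {n m i j : ℕ} (hf : IsAltSeq M f n)
    (hij : i < j) (hj : j ≤ n) (h : SeqReplaces M g m (fun t => f (i + t)) (j - i)) :
    ∃ k, SeqReplaces M k (i + m + (n - j)) f n := by
  have hm : 0 < m := h.pos (hf.segment hj) (by omega)
  have hg := h.isAltSeq
  have h0 : g 0 = f i := h.zero
  have hl : g m = f j := by rw [h.last]; congr 1; omega
  have hfe : M.Adj (f i) (f (i + 1)) ↔ M.Adj (g 0) (g 1) := h.first_edge (by omega)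
  have hle : M.Adj (f (j - 1)) (f j) ↔ M.Adj (g (m - 1)) (g m) := by
    rw [← h.last_edge, show i + (j - i - 1) = j - 1 by omega, show i + (j - i) = j by omega]
  have hmem : ∀ t ≤ m, ∃ s, i ≤ s ∧ s ≤ j ∧ g t = f s := by
    intro t ht
    obtain ⟨s, hs, e⟩ := h.mem t ht
    exact ⟨i + s, by omega, by omega, e⟩
  clear h
  -- Splice `g` in place of the segment from `i` to `j`. Matching end colours (`hfe`, `hle`) keep
  -- the seams alternating; no vertex repeats because `g` only uses vertices of the segment.
  let k : ℕ → V := fun t =>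
    if t < i then f t else if t ≤ i + m then g (t - i) else f (t - (i + m) + j)
  have k1 : ∀ t ≤ i, k t = f t := by
    intro t ht
    rcases ht.lt_or_eq with ht | rfl
    · simp [k, ht]
    · simp [k, h0]
  have k2 : ∀ t ≤ m, k (i + t) = g t := by
    intro t ht
    simp [k, ht]
  have k3 : ∀ t, k (i + m + t) = f (j + t) := by
    intro t
    rcases Nat.eq_zero_or_pos t with rfl | ht
    · rw [add_zero, k2 m le_rfl, hl, add_zero]
    · simp only [k]
      rw [if_neg (by omega), if_neg (by omega)]
      congr 1
      omega
  have cases3 : ∀ t, t ≤ i + m + (n - j) →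
      (t < i ∨ (∃ s ≤ m, t = i + s) ∨ ∃ s, 0 < s ∧ s ≤ n - j ∧ t = i + m + s) := by
    intro t ht
    rcases Nat.lt_or_ge t i with h | h
    · exact Or.inl h
    · rcases Nat.lt_or_ge (i + m) t with h' | h'
      · exact Or.inr (Or.inr ⟨t - (i + m), by omega, by omega, by omega⟩)
      · exact Or.inr (Or.inl ⟨t - i, by omega, by omega⟩)
  have edge : ∀ t, t < i + m + (n - j) →
      (t < i ∧ k t = f t ∧ k (t + 1) = f (t + 1)) ∨
      (∃ s < m, t = i + s ∧ k t = g s ∧ k (t + 1) = g (s + 1)) ∨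
      ∃ s < n - j, t = i + m + s ∧ k t = f (j + s) ∧ k (t + 1) = f (j + s + 1) := by
    intro t ht
    rcases Nat.lt_or_ge t i with h | h
    · exact Or.inl ⟨h, k1 t h.le, k1 (t + 1) h⟩
    · rcases Nat.lt_or_ge t (i + m) with h' | h'
      · obtain ⟨s, rfl⟩ := Nat.exists_eq_add_of_le h
        exact Or.inr (Or.inl ⟨s, by omega, rfl, k2 s (by omega), k2 (s + 1) (by omega)⟩)
      · obtain ⟨s, rfl⟩ := Nat.exists_eq_add_of_le h'
        exact Or.inr (Or.inr ⟨s, by omega, rfl, k3 s, k3 (s + 1)⟩)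
  refine ⟨k, ⟨?_, ?_, ?_⟩, ?_, ?_, ?_, ?_, ?_⟩
  · intro t ht
    rcases edge t ht with ⟨h, e1, e2⟩ | ⟨s, hs, -, e1, e2⟩ | ⟨s, hs, -, e1, e2⟩ <;> rw [e1, e2]
    · exact hf.adj t (by omega)
    · exact hg.adj s hs
    · exact hf.adj (j + s) (by omega)
  · have aux : ∀ s ≤ i + m + (n - j), ∀ t ≤ i + m + (n - j), s < t → k s ≠ k t := by
      intro s hs t ht hst e
      rcases cases3 s hs with hs | ⟨s, hs', rfl⟩ | ⟨s, hs0, hs, rfl⟩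
      · rw [k1 s hs.le] at e
        rcases cases3 t ht with ht | ⟨t, ht', rfl⟩ | ⟨t, ht0, ht, rfl⟩
        · rw [k1 t ht.le] at e
          have := hf.inj s (by omega) t (by omega) e
          omega
        · obtain ⟨r, hr1, hr2, hr⟩ := hmem t ht'
          rw [k2 t ht', hr] at e
          have := hf.inj s (by omega) r (by omega) e
          omega
        · rw [k3 t] at e
          have := hf.inj s (by omega) _ (by omega) e
          omega
      · rw [k2 s hs'] at e
        rcases cases3 t ht with ht | ⟨t, ht', rfl⟩ | ⟨t, ht0, ht, rfl⟩
        · omega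
        · rw [k2 t ht'] at e
          have := hg.inj s hs' t ht' e
          omega
        · obtain ⟨r, hr1, hr2, hr⟩ := hmem s hs'
          rw [k3 t, hr] at e
          have := hf.inj r (by omega) _ (by omega) e
          omega
      · obtain ⟨t, rfl⟩ := Nat.exists_eq_add_of_le (show i + m ≤ t by omega)
        rw [k3 s, k3 t] at e
        have := hf.inj _ (by omega) _ (by omega) e
        omega
    intro s hs t ht e
    rcases lt_trichotomy s t with h | h | h
    · exact absurd e (aux s hs t ht h)
    · exact h
    · exact absurd e.symm (aux t ht s hs h)
  · intro t ht
    rcases edge t (by omega) with ⟨h, e1, e2⟩ | ⟨s, hs, hts, e1, e2⟩ | ⟨s, hs, hts, e1, e2⟩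
    · rw [e1, e2]
      rcases Nat.lt_or_ge (t + 1) i with h' | h'
      · rw [k1 (t + 2) h']
        exact hf.alt t (by omega)
      · obtain rfl : i = t + 1 := by omega
        rw [show t + 2 = t + 1 + 1 from rfl, k2 1 (by omega), ← h0, ← hfe, h0]
        exact hf.alt t (by omega)
    · rw [e1, e2]
      rcases Nat.lt_or_ge (s + 1) m with h' | h'
      · rw [show t + 2 = i + (s + 2) by omega, k2 (s + 2) h']
        exact hg.alt s h'
      · obtain rfl : m = s + 1 := by omega
        rw [show t + 2 = i + (s + 1) + 1 by omega, k3 1, hl]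
        rw [Nat.add_sub_cancel, hl] at hle
        rw [← hle]
        have := hf.alt (j - 1) (by omega)
        rwa [show j - 1 + 1 = j by omega, show j - 1 + 2 = j + 1 by omega] at this
    · rw [e1, e2, show t + 2 = i + m + (s + 2) by omega, k3 (s + 2)]
      exact hf.alt (j + s) (by omega)
  · exact k1 0 (by omega)
  · rw [k3 (n - j)]
    congr 1
    omega
  · intro t ht
    rcases cases3 t ht with ht | ⟨t, ht', rfl⟩ | ⟨t, ht0, ht, rfl⟩
    · exact ⟨t, by omega, k1 t ht.le⟩
    · obtain ⟨r, hr1, hr2, hr⟩ := hmem t ht'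
      exact ⟨r, by omega, (k2 t ht').trans hr⟩
    · exact ⟨j + t, by omega, k3 t⟩
  · intro hn
    rw [k1 0 (by omega)]
    rcases Nat.eq_zero_or_pos i with rfl | hi
    · have := k2 1 hm
      rw [zero_add] at this
      rw [this, ← h0]
      simpa [h0] using hfe
    · rw [k1 1 hi]
  · rcases Nat.eq_zero_or_pos (n - j) with e | e
    · obtain rfl : j = n := by omega
      rw [e, add_zero, k2 m le_rfl, show i + m - 1 = i + (m - 1) by omega, k2 (m - 1) (by omega)]
      exact hle
    · rw [k3 (n - j), show i + m + (n - j) - 1 = i + m + (n - j - 1) by omega, k3 (n - j - 1),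
        show j + (n - j) = n by omega, show j + (n - j - 1) = n - 1 by omega]

lemma IsReduced.segment {f : ℕ → V} {n : ℕ} (hf : IsReduced M f n) {i j : ℕ} (hij : i ≤ j)
    (hj : j ≤ n) : IsReduced M (fun t => f (i + t)) (j - i) := by
  refine ⟨hf.1.segment hj, fun g m h => ?_⟩
  rcases hij.eq_or_lt with rfl | hij
  · omega
  · obtain ⟨k, hk⟩ := exists_seqReplaces_of_segment hf.1 hij hj h
    have := hf.2 _ _ hk
    omega

/-- In a reduced path, a segment that begins and ends with edges outside `M` has no chord outside
`M` between its ends. -/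
lemma IsReduced.not_adj {f : ℕ → V} {n : ℕ} (hf : IsReduced M f n) {i j : ℕ}
    (hij : i + 1 < j) (hj : j ≤ n) (hi : ¬ M.Adj (f i) (f (i + 1)))
    (hj' : ¬ M.Adj (f (j - 1)) (f j)) (hM : ¬ M.Adj (f i) (f j)) : ¬ G.Adj (f i) (f j) := by
  intro h
  have hij' : f i ≠ f j := h.ne
  -- The single blue edge is a replacement of length 1 for the segment, which has length at least 2.
  have := (hf.segment (i := i) (j := j) (by omega) hj).2
    (fun t => if t = 0 then f i else f j) 1 (by
      refine ⟨⟨?_, ?_, ?_⟩, ?_, ?_, ?_, ?_, ?_⟩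
      · intro t ht
        obtain rfl : t = 0 := by omega
        simpa using h
      · intro s hs t ht e
        by_contra hst
        have : (s = 0 ∧ t = 1) ∨ (s = 1 ∧ t = 0) := by omega
        rcases this with ⟨rfl, rfl⟩ | ⟨rfl, rfl⟩
        · exact hij' (by simpa using e)
        · exact hij' (by simpa using e.symm)
      · intro t ht
        omega
      · simp
      · simp [show i + (j - i) = j by omega]
      · intro t ht
        rcases Nat.eq_zero_or_pos t with rfl | ht0
        · exact ⟨0, by omega, by simp⟩
        · exact ⟨j - i, le_rfl, by simp [ht0.ne', show i + (j - i) = j by omega]⟩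
      · intro _
        simp [hi, hM]
      · simp [show i + (j - i) = j by omega, show i + (j - i - 1) = j - 1 by omega, hj', hM])
  omega

/-- By `hends` the path continues beyond an end of the segment, with a red edge; this uses up the
matching edge there, so the chord is blue. Were the segment the whole path, the chord could be red.
-/
lemma IsReduced.not_adj_of_blue (hMm : M.IsMatching) {f : ℕ → V} {n : ℕ} (hf : IsReduced M f n)
    {i j : ℕ} (hij : i < j) (hj : j < n) (hi : ¬ M.Adj (f i) (f (i + 1)))
    (hj' : ¬ M.Adj (f j) (f (j + 1))) (hends : 0 < i ∨ j + 1 < n) :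
    ¬ G.Adj (f i) (f (j + 1)) := by
  refine hf.not_adj (by omega) hj hi hj' fun h => ?_
  rcases hends with h0 | h0
  · have h1 : M.Adj (f (i - 1)) (f i) := by
      have := hf.1.alt (i - 1) (by omega)
      rw [show i - 1 + 1 = i by omega, show i - 1 + 2 = i + 1 by omega] at this
      exact this.2 hi
    have := hf.1.inj _ (by omega) _ (by omega) (hMm.eq_of_adj_left h h1.symm)
    omega
  · have h1 : M.Adj (f (j + 1)) (f (j + 2)) := by
      by_contra hc
      exact hj' ((hf.1.alt j h0).2 hc)
    have := hf.1.inj _ (by omega) _ (by omega) (hMm.eq_of_adj_left h.symm h1)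
    omega

/-- The segment strictly between two red edges starts and ends blue, and its ends are already
matched by those red edges, so a chord would be blue. -/
lemma IsReduced.not_adj_of_red (hMm : M.IsMatching) {f : ℕ → V} {n : ℕ} (hf : IsReduced M f n)
    {i j : ℕ} (hij : i + 2 < j) (hj : j < n) (hi : M.Adj (f i) (f (i + 1)))
    (hj' : M.Adj (f j) (f (j + 1))) : ¬ G.Adj (f (i + 1)) (f j) := by
  refine hf.not_adj (by omega) hj.le ((hf.1.alt i (by omega)).1 hi) (fun h => ?_) fun h => ?_
  · have := hf.1.alt (j - 1) (by omega)
    rw [show j - 1 + 1 = j by omega, show j - 1 + 2 = j + 1 by omega] at this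
    exact this.1 h hj'
  · have := hf.1.inj _ (by omega) _ (by omega) (hMm.eq_of_adj_left h hi.symm)
    omega

end Sequences

/-! ### Bounding the crossings between classes. -/

section Counting

lemma exists_strictMono_of_le_card {s : Finset ℕ} {m : ℕ} (h : m ≤ s.card) :
    ∃ e : Fin m → ℕ, StrictMono e ∧ ∀ a, e a ∈ s :=
  ⟨fun a => s.orderEmbOfFin rfl (Fin.castLE h a),
    fun _ _ hab => (s.orderEmbOfFin rfl).strictMono (by simpa using hab),
    fun _ => s.orderEmbOfFin_mem rfl _⟩

/-- If all gaps of a set `X` in `[0, n]` have length at most `L`, then `n` is bounded in terms of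
the size of `X`. -/
lemma le_of_gaps_le {X : ℕ → Prop} [DecidablePred X] {L : ℕ} (n : ℕ)
    (h : ∀ a b, a ≤ b → b ≤ n → (∀ i, a ≤ i → i < b → ¬ X i) → b - a ≤ L) :
    n ≤ ((Finset.range n).filter X).card * (L + 1) + L := by
  induction n using Nat.strong_induction_on with
  | _ n ih =>
    by_cases hX : ((Finset.range n).filter X).Nonempty
    -- Split at the last element of `X`: what follows it is a gap, what precedes it is covered by
    -- induction.
    · set i := ((Finset.range n).filter X).max' hX with hi
      have him := ((Finset.range n).filter X).max'_mem hX
      rw [← hi, Finset.mem_filter, Finset.mem_range] at him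
      have h1 := ih i him.1 fun a b hab hb => h a b hab (by omega)
      have h2 := h (i + 1) n him.1 le_rfl fun t ht htn hXt => by
        have := ((Finset.range n).filter X).le_max' t (by simp [htn, hXt])
        omega
      have h3 : ((Finset.range i).filter X).card + 1 ≤ ((Finset.range n).filter X).card := by
        rw [← Finset.card_insert_of_notMem (a := i) (by simp)]
        refine Finset.card_le_card fun t => ?_
        simp only [Finset.mem_insert, Finset.mem_filter, Finset.mem_range]
        rintro (rfl | ⟨ht, hXt⟩)
        · exact him
        · exact ⟨ht.trans him.1, hXt⟩
      calc n ≤ i + (L + 1) := by omega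
        _ ≤ (((Finset.range i).filter X).card + 1) * (L + 1) + L := by linarith
        _ ≤ _ := by gcongr
    · rw [Finset.not_nonempty_iff_eq_empty, Finset.filter_eq_empty_iff] at hX
      have := h 0 n (by omega) le_rfl fun i _ hi => hX (Finset.mem_range.2 hi)
      omega

variable {V : Type u} {G : SimpleGraph V} {M : G.Subgraph} {ι : Type*}

open Classical in
/-- The edges of the path `f 0, …, f n` that join different classes of `c`. -/
noncomputable def crossings (c : V → ι) (f : ℕ → V) (n : ℕ) : Finset ℕ :=
  (Finset.range n).filter fun i => c (f i) ≠ c (f (i + 1))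

open Classical in
noncomputable def redCrossings (M : G.Subgraph) (c : V → ι) (f : ℕ → V) (n : ℕ) : Finset ℕ :=
  (crossings c f n).filter fun i => M.Adj (f i) (f (i + 1))

open Classical in
noncomputable def blueCrossings (M : G.Subgraph) (c : V → ι) (f : ℕ → V) (n : ℕ) : Finset ℕ :=
  (crossings c f n).filter fun i => ¬ M.Adj (f i) (f (i + 1))

lemma mem_redCrossings {c : V → ι} {f : ℕ → V} {n i : ℕ} : i ∈ redCrossings M c f n ↔
    (i < n ∧ c (f i) ≠ c (f (i + 1))) ∧ M.Adj (f i) (f (i + 1)) := by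
  simp [redCrossings, crossings]

lemma mem_blueCrossings {c : V → ι} {f : ℕ → V} {n i : ℕ} : i ∈ blueCrossings M c f n ↔
    (i < n ∧ c (f i) ≠ c (f (i + 1))) ∧ ¬ M.Adj (f i) (f (i + 1)) := by
  simp [blueCrossings, crossings]

lemma card_red_add_card_blue (M : G.Subgraph) (c : V → ι) (f : ℕ → V) (n : ℕ) :
    (redCrossings M c f n).card + (blueCrossings M c f n).card = (crossings c f n).card :=
  by
    classical
    exact Finset.card_filter_add_card_filter_not _

lemma IsReduced.add_two_le_of_red {f : ℕ → V} {n : ℕ} (hf : IsReduced M f n) {i j : ℕ}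
    (hij : i < j) (hj : j < n) (hi : M.Adj (f i) (f (i + 1)))
    (hj' : M.Adj (f j) (f (j + 1))) : i + 2 ≤ j := by
  by_contra h
  obtain rfl : j = i + 1 := by omega
  exact (hf.1.alt i hj).1 hi hj'

/-- A reduced path has few crossings between the classes of a partition into modules. -/
lemma IsReduced.card_crossings_le_of_modules (hMm : M.IsMatching) {f : ℕ → V} {n : ℕ}
    (hf : IsReduced M f n) {c : V → ι}
    (hc : ∀ i ≤ n, ∀ j ≤ n, ∀ k ≤ n, c (f i) = c (f j) → c (f i) ≠ c (f k) →
      G.Adj (f i) (f k) → G.Adj (f j) (f k))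
    (T : Finset ι) (hT : ∀ i ≤ n, c (f i) ∈ T) : (crossings c f n).card ≤ 4 * T.card := by
  classical
  have hblue : (blueCrossings M c f n).card ≤ 2 * T.card := by
    refine Finset.card_le_mul_card_image_of_maps_to (f := fun i => c (f i)) (fun i hi => hT i
      (mem_blueCrossings.1 hi).1.1.le) 2 fun A _ => ?_
    by_contra! hlt
    obtain ⟨e, he, hes⟩ := exists_strictMono_of_le_card (m := 3) hlt
    have h01 := he (show (0 : Fin 3) < 1 by decide)
    have h12 := he (show (1 : Fin 3) < 2 by decide)
    simp only [Finset.mem_filter, mem_blueCrossings] at hes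
    obtain ⟨⟨⟨-, -⟩, hb0⟩, hA0⟩ := hes 0
    obtain ⟨⟨⟨h1n, hx1⟩, hb1⟩, hA1⟩ := hes 1
    obtain ⟨⟨⟨h2n, -⟩, -⟩, -⟩ := hes 2
    -- Both crossings leave `A`, so the head of the second is also adjacent to the tail of the
    -- first. The third crossing only ensures that the path goes on.
    exact hf.not_adj_of_blue hMm h01 h1n hb0 hb1 (Or.inr (by omega))
      (hc (e 1) (by omega) (e 0) (by omega) (e 1 + 1) (by omega) (hA1.trans hA0.symm) hx1
        (hf.1.adj _ h1n))
  have hred : (redCrossings M c f n).card ≤ 2 * T.card := by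
    refine Finset.card_le_mul_card_image_of_maps_to (f := fun i => c (f (i + 1))) (fun i hi => hT (i + 1)
      (mem_redCrossings.1 hi).1.1) 2 fun A _ => ?_
    by_contra! hlt
    obtain ⟨e, he, hes⟩ := exists_strictMono_of_le_card (m := 3) hlt
    have h01 := he (show (0 : Fin 3) < 1 by decide)
    have h12 := he (show (1 : Fin 3) < 2 by decide)
    simp only [Finset.mem_filter, mem_redCrossings] at hes
    obtain ⟨⟨⟨-, -⟩, hr0⟩, hA0⟩ := hes 0
    obtain ⟨⟨⟨h1n, -⟩, hr1⟩, -⟩ := hes 1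
    obtain ⟨⟨⟨h2n, hx2⟩, hr2⟩, hA2⟩ := hes 2
    have := hf.add_two_le_of_red h01 h1n hr0 hr1
    -- Red crossings are classified by the class they enter. The middle one only guarantees that the
    -- segment between the outer two has more than one edge.
    exact hf.not_adj_of_red hMm (by omega) h2n hr0 hr2
      (hc (e 2 + 1) (by omega) (e 0 + 1) (by omega) (e 2) (by omega) (hA2.trans hA0.symm) hx2.symm
        (hf.1.adj _ h2n).symm)
  have := card_red_add_card_blue M c f n
  omega

/-- A reduced path has few crossings between the classes of a complete multipartite partition. -/
lemma IsReduced.card_crossings_le_of_join (hMm : M.IsMatching) {f : ℕ → V} {n : ℕ}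
    (hf : IsReduced M f n) {c : V → ι}
    (hc : ∀ i ≤ n, ∀ j ≤ n, c (f i) ≠ c (f j) → G.Adj (f i) (f j)) :
    (crossings c f n).card ≤ 7 := by
  have hblue : (blueCrossings M c f n).card ≤ 3 := by
    by_contra! hlt
    obtain ⟨e, he, hes⟩ := exists_strictMono_of_le_card (m := 4) hlt
    have h01 := he (show (0 : Fin 4) < 1 by decide)
    have h12 := he (show (1 : Fin 4) < 2 by decide)
    have h23 := he (show (2 : Fin 4) < 3 by decide)
    simp only [mem_blueCrossings] at hes
    -- Vertices in different classes are adjacent, so a forbidden chord forces equal classes; enough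
    -- such equalities give both ends of crossing `e 1` the same class.
    have key : ∀ a b, e a < e b → e b + 1 < n → c (f (e a)) = c (f (e b + 1)) := by
      intro a b hab hb
      by_contra hne
      exact hf.not_adj_of_blue hMm hab (hes b).1.1 (hes a).2 (hes b).2 (Or.inr hb)
        (hc _ (by omega) _ (by omega) hne)
    have h3 := (hes 3).1.1
    exact (hes 1).1.2 (((key 1 2 h12 (by omega)).trans (key 0 2 (by omega) (by omega)).symm).trans
      (key 0 1 h01 (by omega)))
  have hred : (redCrossings M c f n).card ≤ 4 := by
    by_contra! hlt
    obtain ⟨e, he, hes⟩ := exists_strictMono_of_le_card (m := 5) hlt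
    have h01 := he (show (0 : Fin 5) < 1 by decide)
    have h12 := he (show (1 : Fin 5) < 2 by decide)
    have h23 := he (show (2 : Fin 5) < 3 by decide)
    have h34 := he (show (3 : Fin 5) < 4 by decide)
    simp only [mem_redCrossings] at hes
    have key : ∀ a b d, e a < e b → e b < e d → c (f (e a + 1)) = c (f (e d)) := by
      intro a b d hab hbd
      by_contra hne
      have h1 := hf.add_two_le_of_red hab (hes b).1.1 (hes a).2 (hes b).2
      have h2 := (hes d).1.1
      exact hf.not_adj_of_red hMm (by omega) h2 (hes a).2 (hes d).2
        (hc _ (by omega) _ (by omega) hne)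
    exact (hes 2).1.2 (((key 0 1 2 h01 h12).symm.trans (key 0 1 4 h01 (by omega))).trans
      (key 2 3 4 h23 h34).symm)
  have := card_red_add_card_blue M c f n
  omega

/-- A stretch without crossings is a reduced path within one class, so `L` bounds the gaps between
crossings. -/
lemma IsReduced.le_of_classes {f : ℕ → V} {n : ℕ} (hf : IsReduced M f n) {c : V → ι} {L : ℕ}
    (hL : ∀ g m, IsReduced M g m → (∀ i ≤ m, ∃ j ≤ n, g i = f j) →
      (∀ i ≤ m, c (g i) = c (g 0)) → m ≤ L) :
    n ≤ (crossings c f n).card * (L + 1) + L := by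
  classical
  have key := le_of_gaps_le (X := fun i => c (f i) ≠ c (f (i + 1))) (L := L) n
    fun a b hab hb hX => ?_
  · convert key using 3
    unfold crossings
    congr!
  · refine hL _ _ (hf.segment hab hb) (fun i hi => ⟨a + i, by omega, rfl⟩) fun i hi => ?_
    induction i with
    | zero => rfl
    | succ i ih =>
      rw [← ih (by omega)]
      exact (not_not.1 (hX (a + i) (by omega) (by omega))).symm

end Counting

/-! ### The modular decomposition tree and the induction along it. -/

section Tree

variable {V : Type u} {G : SimpleGraph V}

lemma ssubset_of_mem_children {S T : Set V} (h : T ∈ children G S) : T ⊂ S := by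
  obtain ⟨A, hA, rfl⟩ := h
  obtain ⟨⟨x, hxS⟩, hx⟩ := (Set.ne_univ_iff_exists_notMem _).1 (maximal_of_mem_modularPartition hA).prop.2.2
  refine Set.ssubset_iff_of_subset (Subtype.coe_image_subset S A) |>.2 ⟨x, hxS, ?_⟩
  rintro ⟨y, hy, e⟩
  exact hx ((Subtype.ext e : y = ⟨x, hxS⟩) ▸ hy)

/-- Bounds the depths of nodes, so that the supremum in `modularDepth` is a genuine one. -/
lemma IsNodeAt.add_ncard_le [Finite V] {d : ℕ} {S : Set V} (h : IsNodeAt G d S) :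
    d + S.ncard ≤ Nat.card V := by
  induction h with
  | root => simp [Set.ncard_univ]
  | child hS hT ih =>
    have := Set.ncard_lt_ncard (ssubset_of_mem_children hT)
    omega

lemma IsNodeAt.le_modularDepth [Finite V] {d : ℕ} {S : Set V} (h : IsNodeAt G d S) :
    d ≤ modularDepth G := by
  refine le_csSup ⟨Nat.card V, ?_⟩ ⟨S, h⟩
  rintro d ⟨S, h⟩
  have := h.add_ncard_le
  omega

lemma IsNodeAt.ncard_children_le [Finite V] {d : ℕ} {S : Set V} (h : IsNodeAt G d S)
    (hp : IsPrimeNode G S) : (children G S).ncard ≤ modularWidth G := by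
  refine le_max_of_le_right (le_csSup ⟨Nat.card (Set V), ?_⟩ ⟨d, S, h, hp, rfl⟩)
  rintro k ⟨d, S, -, -, rfl⟩
  exact Set.ncard_le_card _

/-- The classes of a node are its children. -/
lemma exists_children_coloring [Finite V] (G : SimpleGraph V) {S : Set V} (hS : S.Nontrivial) :
    ∃ c : V → Set V, (∀ x ∈ S, c x ∈ children G S ∧ x ∈ c x) ∧
      ((∀ x ∈ S, ∀ y ∈ S, c x ≠ c y → ¬ G.Adj x y) ∨
       (∀ x ∈ S, ∀ y ∈ S, c x ≠ c y → G.Adj x y) ∨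
       (IsPrimeNode G S ∧ ∀ x ∈ S, ∀ y ∈ S, ∀ z ∈ S, c x = c y → c x ≠ c z →
          G.Adj x z → G.Adj y z)) := by
  classical
  have : Nontrivial S := hS.coe_sort
  choose b hb hxb using exists_mem_modularPartition (G.induce S)
  let c : V → Set V := fun x => if h : x ∈ S then Subtype.val '' b ⟨x, h⟩ else ∅
  have hcx : ∀ x (h : x ∈ S), c x = Subtype.val '' b ⟨x, h⟩ := fun x h => dif_pos h
  have hbc : ∀ x (hx : x ∈ S) y (hy : y ∈ S), c x ≠ c y → (⟨y, hy⟩ : S) ∉ b ⟨x, hx⟩ := by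
    intro x hx y hy hne hmem
    apply hne
    rw [hcx x hx, hcx y hy, eq_of_mem_modularPartition (hb ⟨x, hx⟩) (hb ⟨y, hy⟩) hmem (hxb _)]
  refine ⟨c, fun x hx => ?_, ?_⟩
  · rw [hcx x hx]
    exact ⟨⟨_, hb _, rfl⟩, ⟨x, hx⟩, hxb _, rfl⟩
  · rcases modularPartition_trichotomy (G.induce S) with h | h | h
    · exact Or.inl fun x hx y hy hne =>
        h _ (hb ⟨x, hx⟩) ⟨x, hx⟩ (hxb _) ⟨y, hy⟩ (hbc x hx y hy hne)
    · exact Or.inr (Or.inl fun x hx y hy hne =>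
        h _ (hb ⟨x, hx⟩) ⟨x, hx⟩ (hxb _) ⟨y, hy⟩ (hbc x hx y hy hne))
    · refine Or.inr (Or.inr ⟨h, fun x hx y hy z hz hxy hxz hadj => ?_⟩)
      have hyx : (⟨y, hy⟩ : S) ∈ b ⟨x, hx⟩ := by
        rw [hcx x hx, hcx y hy] at hxy
        rw [Subtype.val_injective.image_injective hxy]
        exact hxb _
      exact isModule_iff.1 (maximal_of_mem_modularPartition (hb ⟨x, hx⟩)).prop.1.1 ⟨x, hx⟩ (hxb _) ⟨y, hy⟩ hyx ⟨z, hz⟩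
        (hbc x hx z hz hxz) hadj

/-- A reduced alternating path inside a node of the modular decomposition tree is short. -/
lemma IsReduced.le_of_isNodeAt [Finite V] {M : G.Subgraph} (hMm : M.IsMatching) (e : ℕ) :
    ∀ {d : ℕ} {S : Set V}, IsNodeAt G d S → d + e = modularDepth G → ∀ {f : ℕ → V} {n : ℕ},
      IsReduced M f n → (∀ i ≤ n, f i ∈ S) → n ≤ (21 * modularWidth G) ^ e := by
  have hw : 2 ≤ modularWidth G := le_max_left _ _
  induction e with
  | zero =>
    intro d S hS hd f n hf hfS
    -- At maximal depth a node with two vertices would have a child that is too deep, so the path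
    -- has no edge.
    rcases S.subsingleton_or_nontrivial with h | h
    · have := hf.1.inj 0 (by omega) n le_rfl (h (hfS 0 (by omega)) (hfS n le_rfl))
      omega
    · obtain ⟨c, hc, -⟩ := exists_children_coloring G h
      have := (hS.child (hc _ (hfS 0 (by omega))).1).le_modularDepth
      omega
  | succ e ih =>
    intro d S hS hd f n hf hfS
    rcases S.subsingleton_or_nontrivial with h | h
    · have := hf.1.inj 0 (by omega) n le_rfl (h (hfS 0 (by omega)) (hfS n le_rfl))
      omega
    · obtain ⟨c, hc, htri⟩ := exists_children_coloring G h
      set L := (21 * modularWidth G) ^ e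
      have hL : 1 ≤ L := Nat.one_le_pow _ _ (by omega)
      have hn : n ≤ (crossings c f n).card * (L + 1) + L := by
        refine hf.le_of_classes fun g m hg hgf hgc => ?_
        have hgS : ∀ i ≤ m, g i ∈ S := by
          intro i hi
          obtain ⟨j, hj, hij⟩ := hgf i hi
          exact hij ▸ hfS j hj
        refine ih (hS.child (hc _ (hgS 0 (by omega))).1) (by omega) hg fun i hi => ?_
        rw [← hgc i hi]
        exact (hc _ (hgS i hi)).2
      have hX : (crossings c f n).card ≤ 4 * modularWidth G := by
        rcases htri with h | h | ⟨hp, h⟩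
        · have : crossings c f n = ∅ := by
            refine Finset.filter_eq_empty_iff.2 fun i hi hne => ?_
            rw [Finset.mem_range] at hi
            exact h _ (hfS i hi.le) _ (hfS (i + 1) hi) hne (hf.1.adj i hi)
          simp [this]
        · have := hf.card_crossings_le_of_join hMm (c := c)
            fun i hi j hj => h _ (hfS i hi) _ (hfS j hj)
          omega
        · have h1 := hf.card_crossings_le_of_modules hMm (c := c)
            (fun i hi j hj k hk => h _ (hfS i hi) _ (hfS j hj) _ (hfS k hk))
            (Set.toFinite (children G S)).toFinset
            (fun i hi => (Set.Finite.mem_toFinset _).2 (hc _ (hfS i hi)).1)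
          rw [← Set.ncard_eq_toFinset_card] at h1
          have h2 := hS.ncard_children_le hp
          omega
      -- Since `1 ≤ L`, the factor `9 * modularWidth G` already suffices; 21 leaves slack.
      calc n ≤ (crossings c f n).card * (L + 1) + L := hn
        _ ≤ 4 * modularWidth G * (L + L) + modularWidth G * L := by
          gcongr
          exact Nat.le_mul_of_pos_left _ (by omega)
        _ = L * (9 * modularWidth G) := by ring
        _ ≤ L * (21 * modularWidth G) := by gcongr; omega
        _ = _ := (pow_succ _ _).symm

end Tree

/-! ### Translation between walks and sequences. -/

section Walks

variable {V : Type u} {G : SimpleGraph V} {M : G.Subgraph}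

lemma alternates_iff {u v : V} (p : G.Walk u v) :
    p.edges.IsChain (fun e f => e ∈ M.edgeSet ↔ f ∉ M.edgeSet) ↔
      ∀ i, i + 1 < p.length → (M.Adj (p.getVert i) (p.getVert (i + 1)) ↔
        ¬ M.Adj (p.getVert (i + 1)) (p.getVert (i + 2))) := by
  have hget : ∀ {u v : V} (p : G.Walk u v) (i : ℕ) (hi : i < p.edges.length),
      p.edges[i] = s(p.getVert i, p.getVert (i + 1)) := by
    intro u v p
    induction p with
    | nil => intro i hi; simp at hi
    | cons h p ih =>
      intro i hi
      cases i with
      | zero => simp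
      | succ i => simpa using ih i (by simpa using hi)
  rw [List.isChain_iff_getElem]
  simp only [hget, SimpleGraph.Walk.length_edges, SimpleGraph.Subgraph.mem_edgeSet]

lemma IsAlternatingPath.isAltSeq {u v : V} {p : G.Walk u v} (hp : IsAlternatingPath M p) :
    IsAltSeq M p.getVert p.length :=
  ⟨fun _ hi => p.adj_getVert_succ hi, fun _ hi _ hj h => hp.isPath.getVert_injOn hi hj h,
    (alternates_iff p).1 hp.alternates⟩

lemma exists_walk_getVert (n : ℕ) (f : ℕ → V) (hf : ∀ i < n, G.Adj (f i) (f (i + 1))) :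
    ∃ p : G.Walk (f 0) (f n), p.length = n ∧ ∀ i ≤ n, p.getVert i = f i := by
  induction n generalizing f with
  | zero => exact ⟨.nil, rfl, fun i hi => by simp [Nat.le_zero.1 hi]⟩
  | succ n ih =>
    obtain ⟨p, hp, hpf⟩ := ih (fun i => f (i + 1)) fun i hi => hf (i + 1) (by omega)
    refine ⟨.cons (hf 0 (by omega)) p, by simp [hp], fun i hi => ?_⟩
    cases i with
    | zero => simp
    | succ i => simpa using hpf i (by omega)

lemma SeqReplaces.exists_walk {u v : V} {p : G.Walk u v} {g : ℕ → V} {m : ℕ}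
    (hp : IsAltSeq M p.getVert p.length) (h : SeqReplaces M g m p.getVert p.length) :
    ∃ q : G.Walk u v, Replaces M q p ∧ q.length = m := by
  obtain ⟨q, hq, hqg⟩ := exists_walk_getVert m g h.isAltSeq.adj
  have h0 : g 0 = u := by simpa using h.zero
  have hl : g m = v := by simpa using h.last
  subst h0 hl
  refine ⟨q, ⟨⟨?_, ?_⟩, ?_, ?_, ?_⟩, hq⟩
  · rw [← SimpleGraph.Walk.IsPath.getVert_injOn_iff]
    intro i hi j hj e
    rw [Set.mem_ofPred_eq, hq] at hi hj
    rw [hqg i hi, hqg j hj] at e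
    exact h.isAltSeq.inj i hi j hj e
  · rw [alternates_iff]
    intro i hi
    rw [hqg i (by omega), hqg (i + 1) (by omega), hqg (i + 2) (by omega)]
    exact h.isAltSeq.alt i (hq ▸ hi)
  · intro x hx
    obtain ⟨i, rfl, hi⟩ := SimpleGraph.Walk.mem_support_iff_exists_getVert.1 hx
    rw [hq] at hi
    obtain ⟨j, hj, e⟩ := h.mem i hi
    rw [hqg i hi, e]
    exact SimpleGraph.Walk.getVert_mem_support p j
  · rcases Nat.eq_zero_or_pos p.length with hp0 | hp0
    -- For a path without edges `snd` defaults to the endpoint, on both sides.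
    · have hm : m = 0 := h.isAltSeq.inj m le_rfl 0 (by omega) (p.eq_of_length_eq_zero hp0).symm
      have hps : p.snd = g m := p.getVert_of_length_le (by omega)
      have hqs : q.snd = g m := q.getVert_of_length_le (by omega)
      rw [hps, hqs]
    · have hfirst := h.first_edge hp0
      rwa [p.getVert_zero, ← hqg 1 (h.pos hp hp0)] at hfirst
  · have hlast := h.last_edge
    have hpen : q.penultimate = g (m - 1) :=
      (congrArg (fun t => q.getVert (t - 1)) hq).trans (hqg _ (by omega))
    rw [p.getVert_length] at hlast
    rwa [hpen]

end Walks

end ModularMatching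

theorem mainTheorem2 {V : Type*} [Finite V] (G : SimpleGraph V) :
    ModularMatching.IsReplaceable G
      ((21 * ModularMatching.modularWidth G) ^ ModularMatching.modularDepth G) := by
  intro M hM u v p hp
  obtain ⟨g, m, hg, hred⟩ := ModularMatching.exists_isReduced hp.isAltSeq
  obtain ⟨q, hq, rfl⟩ := hg.exists_walk hp.isAltSeq
  exact ⟨q, hq, hred.le_of_isNodeAt hM _ .root (zero_add _) fun _ _ => Set.mem_univ _⟩
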